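/- Let $A$ be an Artin algebra (an algebra that is finitely generated as a module over a commutative Artinian ring), and let $\operatorname{mod} A$ be the category of finitely generated right $A$-modules. For $M\in\operatorname{mod} A$ let $\operatorname{pd} M\in\mathbb N\cup\{\infty\}$ be its projective dimension (with $\operatorname{pd} 0=0$), let $\Omega M$ be the kernel of a projective cover $P(M)\to M$, and let $\Omega^n M$ be the $n$-th iterate. Let $K_0(A)$ be the abelian group generated by the symbols $[M]$, $M\in\operatorname{mod} A$, modulo the relations $[M]-[M']-[M'']$ whenever $M\cong M'\oplus M''$ and $[P]$ for $P$ projective, and let $\bar\Omega\colon K_0(A)\to K_0(A)$ be the endomorphism with $\bar\Omega[M]=[\Omega M]$. Let $\langle\operatorname{add} M\rangle\subseteq K_0(A)$ be the subgroup generated by the classes of the indecomposable direct summands of $M$. The Igusa-Todorov functions are $$\phi(M)=\min\{\,l\ge 0 : \bar\Omega \text{ is injective on } \bar\Omega^{\,l+s}(\langle\operatorname{add} M\rangle)\text{ for all } s\ge 0\,\},$$ $$\psi(M)=\phi(M)+\sup\{\,\operatorname{pd} N : \Omega^{\phi(M)}M\cong N\oplus N' \text{ for some } N',\ \operatorname{pd}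 N<\infty\,\}.$$ Let $0\to M'\to M\to M''\to 0$ be a short exact sequence of finitely generated right $A$-modules. Then: 1. if $\operatorname{pd} M<\infty$, then $\operatorname{pd} M\le \psi(M'\oplus\Omega M'')+1$; 2. if $\operatorname{pd} M'<\infty$, then $\operatorname{pd} M'\le\psi(\Omega M\oplus\Omega M'')+1$. -/

import Mathlib

open CategoryTheory

universe u

namespace IgusaTodorov

/-- `A` is an Artin algebra: a module-finite algebra over a commutative Artinian ring `R`.
(Replacing `R` by its image in `A` one may always take `R` in the universe of `A`.) -/
class IsArtinAlgebra (A : Type u) [Ring A] : Prop where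
  exists_base : ∃ (R : Type u) (_ : CommRing R) (_ : Algebra R A),
    IsArtinianRing R ∧ Module.Finite R A

instance (A : Type u) [Ring A] [IsArtinAlgebra A] : IsArtinAlgebra Aᵐᵒᵖ where
  exists_base := by
    obtain ⟨R, _, _, h1, h2⟩ := IsArtinAlgebra.exists_base (A := A)
    exact ⟨R, inferInstance, inferInstance, h1, inferInstance⟩

instance (A : Type u) [Ring A] [IsArtinAlgebra A] : IsArtinianRing A := by
  obtain ⟨R, _, _, h1, h2⟩ := IsArtinAlgebra.exists_base (A := A)
  exact IsArtinianRing.of_finite R A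

/-! ### Projective covers

All definitions are given for left modules over a left Artinian ring `Λ`; finitely generated right
`A`-modules are the finitely generated left modules over `Λ = Aᵐᵒᵖ`. -/

/-- A submodule `L` of `X` is superfluous (small): `N + L = X` only for `N = X`. -/
def IsSuperfluous {Λ X : Type*} [Ring Λ] [AddCommGroup X] [Module Λ X] (L : Submodule Λ X) : Prop :=
  ∀ N : Submodule Λ X, N ⊔ L = ⊤ → N = ⊤

/-- `f : P → M` is a projective cover of `M`. -/
structure IsProjectiveCover {Λ P M : Type*} [Ring Λ] [AddCommGroup P] [Module Λ P]
    [AddCommGroup M] [Module Λ M] (f : P →ₗ[Λ] M) : Prop where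
  projective : Module.Projective Λ P
  surjective : Function.Surjective f
  superfluous : IsSuperfluous (LinearMap.ker f)

section Covers

variable {Λ : Type*} [Ring Λ] {P Q M N : Type*} [AddCommGroup P] [Module Λ P] [AddCommGroup Q]
  [Module Λ Q] [AddCommGroup M] [Module Λ M] [AddCommGroup N] [Module Λ N]

theorem IsSuperfluous.eq_top_of_sup_map {X Y : Type*} [AddCommGroup X] [Module Λ X]
    [AddCommGroup Y] [Module Λ Y] {L : Submodule Λ X} (hL : IsSuperfluous L) (j : X →ₗ[Λ] Y)
    {K : Submodule Λ Y} (h : K ⊔ L.map j = ⊤) : K = ⊤ := by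
  have h1 : K.comap j = ⊤ := by
    apply hL
    rw [eq_top_iff]
    intro x _
    have hx : j x ∈ K ⊔ L.map j := h ▸ Submodule.mem_top
    obtain ⟨k, hk, y, ⟨l, hl, rfl⟩, hy⟩ := Submodule.mem_sup.1 hx
    refine Submodule.mem_sup.2 ⟨x - l, ?_, l, hl, by abel⟩
    rw [Submodule.mem_comap, map_sub, ← hy]
    simpa using hk
  have h2 : L.map j ≤ K := by
    rintro _ ⟨l, -, rfl⟩
    have : l ∈ K.comap j := h1 ▸ Submodule.mem_top
    exact this
  rwa [sup_eq_left.2 h2] at h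

/-- The kernels of two projective covers of isomorphic modules are isomorphic. -/
theorem IsProjectiveCover.nonempty_ker_equiv {f : P →ₗ[Λ] M} {g : Q →ₗ[Λ] N}
    (hf : IsProjectiveCover f) (hg : IsProjectiveCover g) (e : M ≃ₗ[Λ] N) :
    Nonempty (LinearMap.ker f ≃ₗ[Λ] LinearMap.ker g) := by
  have := hf.projective
  have := hg.projective
  obtain ⟨a, ha⟩ := Module.projective_lifting_property g (e.toLinearMap ∘ₗ f) hg.surjective
  have ha' : ∀ p, g (a p) = e (f p) := fun p => LinearMap.congr_fun ha p
  have hasurj : Function.Surjective a := by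
    rw [← LinearMap.range_eq_top]
    apply hg.superfluous
    rw [eq_top_iff]
    intro q _
    obtain ⟨p, hp⟩ := hf.surjective (e.symm (g q))
    refine Submodule.mem_sup.2 ⟨a p, ⟨p, rfl⟩, q - a p, ?_, by abel⟩
    rw [LinearMap.mem_ker, map_sub, ha', hp]
    simp
  obtain ⟨s, hs⟩ := Module.projective_lifting_property a LinearMap.id hasurj
  have hs' : ∀ q, a (s q) = q := fun q => LinearMap.congr_fun hs q
  have hssurj : Function.Surjective s := by
    rw [← LinearMap.range_eq_top]
    apply hf.superfluous
    rw [eq_top_iff]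
    intro p _
    refine Submodule.mem_sup.2 ⟨s (a p), ⟨a p, rfl⟩, p - s (a p), ?_, by abel⟩
    rw [LinearMap.mem_ker, map_sub, sub_eq_zero]
    apply e.injective
    rw [← ha', ← ha', hs']
  have hainj : Function.Injective a := by
    intro p p' h
    obtain ⟨q, rfl⟩ := hssurj p
    obtain ⟨q', rfl⟩ := hssurj p'
    rw [hs', hs'] at h
    rw [h]
  let a' : P ≃ₗ[Λ] Q := LinearEquiv.ofBijective a ⟨hainj, hasurj⟩
  refine ⟨a'.ofSubmodules _ _ ?_⟩
  ext q
  constructor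
  · rintro ⟨p, hp, rfl⟩
    have hp' : f p = 0 := hp
    change g (a p) = 0
    rw [ha', hp', map_zero]
  · intro hq
    have hq' : g q = 0 := hq
    obtain ⟨p, rfl⟩ := hasurj q
    refine ⟨p, ?_, rfl⟩
    rw [ha'] at hq'
    exact e.injective (by simpa using hq')

/-- The direct sum of two projective covers is a projective cover. -/
theorem IsProjectiveCover.prodMap {f : P →ₗ[Λ] M} {g : Q →ₗ[Λ] N}
    (hf : IsProjectiveCover f) (hg : IsProjectiveCover g) :
    IsProjectiveCover (f.prodMap g) := by
  have := hf.projective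
  have := hg.projective
  refine ⟨inferInstance, ?_, ?_⟩
  · rw [LinearMap.coe_prodMap]
    exact hf.surjective.prodMap hg.surjective
  · intro K hK
    have hker : LinearMap.ker (f.prodMap g) ≤
        (LinearMap.ker f).map (LinearMap.inl Λ P Q) ⊔ (LinearMap.ker g).map (LinearMap.inr Λ P Q) := by
      rintro ⟨p, q⟩ h
      rw [LinearMap.mem_ker, LinearMap.prodMap_apply, Prod.mk_eq_zero] at h
      refine Submodule.mem_sup.2 ⟨(p, 0), ⟨p, h.1, rfl⟩, (0, q), ⟨q, h.2, rfl⟩, by simp⟩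
    have h1 : K ⊔ (LinearMap.ker f).map (LinearMap.inl Λ P Q) ⊔
        (LinearMap.ker g).map (LinearMap.inr Λ P Q) = ⊤ := by
      rw [sup_assoc, eq_top_iff, ← hK]
      exact sup_le_sup_left hker K
    exact hf.superfluous.eq_top_of_sup_map _ (hg.superfluous.eq_top_of_sup_map _ h1)

/-- The kernel of a direct sum of two maps is the direct sum of the kernels. -/
def kerProdMapEquiv (f : P →ₗ[Λ] M) (g : Q →ₗ[Λ] N) :
    LinearMap.ker (f.prodMap g) ≃ₗ[Λ] LinearMap.ker f × LinearMap.ker g where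
  toFun x := (⟨x.1.1, (Prod.mk_eq_zero.1 x.2).1⟩, ⟨x.1.2, (Prod.mk_eq_zero.1 x.2).2⟩)
  invFun y := ⟨(y.1.1, y.2.1), Prod.mk_eq_zero.2 ⟨y.1.2, y.2.2⟩⟩
  map_add' _ _ := rfl
  map_smul' _ _ := rfl
  left_inv _ := rfl
  right_inv _ := rfl

theorem isProjectiveCover_id [Module.Projective Λ P] :
    IsProjectiveCover (LinearMap.id : P →ₗ[Λ] P) :=
  ⟨inferInstance, Function.surjective_id, fun N h => by simpa using h⟩

end Covers

/-- Over a left Artinian ring every finitely generated module has a projective cover, with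
finitely generated source. -/
theorem exists_isProjectiveCover {Λ : Type u} [Ring Λ] [IsArtinianRing Λ] (M : FGModuleCat.{u} Λ) :
    ∃ (P : FGModuleCat.{u} Λ) (f : P →ₗ[Λ] M), IsProjectiveCover f := by
  obtain ⟨n, π, hπ⟩ := Module.Finite.exists_fin' Λ M
  let S : Set (Submodule Λ (Fin n → Λ)) := {Q | Module.Projective Λ Q ∧ Q.map π = ⊤}
  have hS : S.Nonempty := by
    refine ⟨⊤, Module.Projective.of_equiv (Submodule.topEquiv (R := Λ) (M := Fin n → Λ)).symm, ?_⟩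
    rw [Submodule.map_top, LinearMap.range_eq_top.2 hπ]
  obtain ⟨Q, ⟨hQ, hQπ⟩, hmin⟩ := IsArtinian.set_has_minimal S hS
  let f : Q →ₗ[Λ] M := π ∘ₗ Q.subtype
  have hf : Function.Surjective f := by
    rw [← LinearMap.range_eq_top, LinearMap.range_comp, Submodule.range_subtype, hQπ]
  refine ⟨FGModuleCat.of Λ Q, f, hQ, hf, ?_⟩
  intro N hN
  have hfN : Function.Surjective (f ∘ₗ N.subtype) := by
    intro m
    obtain ⟨q, rfl⟩ := hf m
    have hq : q ∈ N ⊔ LinearMap.ker f := hN ▸ Submodule.mem_top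
    obtain ⟨x, hx, k, hk, rfl⟩ := Submodule.mem_sup.1 hq
    refine ⟨⟨x, hx⟩, ?_⟩
    have hk' : f k = 0 := hk
    rw [map_add, hk', add_zero]
    rfl
  obtain ⟨g, hg⟩ := Module.projective_lifting_property (f ∘ₗ N.subtype) f hfN
  let h : Module.End Λ Q := N.subtype ∘ₗ g
  have hfh : ∀ q, f (h q) = f q := fun q => LinearMap.congr_fun hg q
  have hfhn : ∀ (k : ℕ) q, f ((h ^ k) q) = f q := by
    intro k
    induction k with
    | zero => intro q; rfl
    | succ k ih => intro q; rw [pow_succ', Module.End.mul_apply, hfh, ih]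
  obtain ⟨k, hk⟩ := Filter.eventually_atTop.1 (LinearMap.eventually_isCompl_ker_pow_range_pow h)
  have hc := hk (k + 1) (Nat.le_succ k)
  set W := LinearMap.range (h ^ (k + 1)) with hW
  have hWproj : Module.Projective Λ W :=
    Module.Projective.of_split W.subtype (W.projectionOnto _ hc.symm) (by
      ext x; simp)
  have hWS : W.map Q.subtype ∈ S := by
    refine ⟨Module.Projective.of_equiv
      (Submodule.equivMapOfInjective Q.subtype Q.injective_subtype W), ?_⟩
    rw [eq_top_iff]
    intro m _
    obtain ⟨q, rfl⟩ := hf m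
    exact ⟨_, ⟨_, ⟨q, rfl⟩, rfl⟩, hfhn (k + 1) q⟩
  have hWtop : W = ⊤ := by
    by_contra hne
    refine hmin _ hWS (lt_of_le_of_ne (Submodule.map_subtype_le Q W) fun heq => hne ?_)
    rw [eq_top_iff]
    intro q _
    have hq : (q : Fin n → Λ) ∈ W.map Q.subtype := by rw [heq]; exact q.2
    obtain ⟨w, hw, hwq⟩ := hq
    rwa [← Subtype.ext hwq]
  rw [eq_top_iff, ← hWtop]
  rintro _ ⟨q, rfl⟩
  rw [pow_succ', Module.End.mul_apply]
  exact (g _).2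

section Functions

variable {Λ : Type u} [Ring Λ]

/-- The projective dimension of a finitely generated module, in `ℕ ∪ {∞}`. It is Mathlib's
projective dimension, except that the zero module gets `0` instead of `-∞`. -/
noncomputable def pd (M : FGModuleCat.{u} Λ) : ℕ∞ :=
  (projectiveDimension M.obj).unbotD 0

/-- An indecomposable module: nonzero, and not a direct sum of two nonzero submodules. -/
def IsIndecomposable (M : FGModuleCat.{u} Λ) : Prop :=
  Nontrivial M ∧ ∀ U V : Submodule Λ M, IsCompl U V → U = ⊥ ∨ V = ⊥

/-- The relations of `K₀`: `[M] - [M'] - [M'']` for `M ≅ M' ⊕ M''`, and `[P]` for `P` projective. -/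
def K₀Relations (Λ : Type u) [Ring Λ] : Set (FreeAbelianGroup (FGModuleCat.{u} Λ)) :=
  {x | ∃ M M' M'' : FGModuleCat.{u} Λ, Nonempty (M ≃ₗ[Λ] M' × M'') ∧
      x = FreeAbelianGroup.of M - FreeAbelianGroup.of M' - FreeAbelianGroup.of M''} ∪
  {x | ∃ P : FGModuleCat.{u} Λ, Module.Projective Λ P ∧ x = FreeAbelianGroup.of P}

/-- The group `K₀` generated by all f.g. modules modulo the relations above. -/
abbrev K₀ (Λ : Type u) [Ring Λ] : Type (u + 1) :=
  FreeAbelianGroup (FGModuleCat.{u} Λ) ⧸ AddSubgroup.closure (K₀Relations Λ)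

/-- The class `[M]` in `K₀`. -/
def K₀.mk (M : FGModuleCat.{u} Λ) : K₀ Λ :=
  QuotientAddGroup.mk (FreeAbelianGroup.of M)

theorem K₀.mk_eq_add {M M' M'' : FGModuleCat.{u} Λ} (e : M ≃ₗ[Λ] M' × M'') :
    K₀.mk M = K₀.mk M' + K₀.mk M'' := by
  have h : FreeAbelianGroup.of M - FreeAbelianGroup.of M' - FreeAbelianGroup.of M'' ∈
      AddSubgroup.closure (K₀Relations Λ) :=
    AddSubgroup.subset_closure (Or.inl ⟨M, M', M'', ⟨e⟩, rfl⟩)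
  have h' := (QuotientAddGroup.eq_zero_iff _).2 h
  rw [QuotientAddGroup.mk_sub, QuotientAddGroup.mk_sub, sub_sub, sub_eq_zero] at h'
  exact h'

theorem K₀.mk_eq_zero {P : FGModuleCat.{u} Λ} (h : Module.Projective Λ P) : K₀.mk P = 0 :=
  (QuotientAddGroup.eq_zero_iff _).2 (AddSubgroup.subset_closure (Or.inr ⟨P, h, rfl⟩))

/-- `⟨add M⟩`: the subgroup of `K₀` generated by the classes of the indecomposable direct summands
of `M`. -/
def addSpan (M : FGModuleCat.{u} Λ) : AddSubgroup (K₀ Λ) :=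
  AddSubgroup.closure {x | ∃ N N' : FGModuleCat.{u} Λ,
    IsIndecomposable N ∧ Nonempty (M ≃ₗ[Λ] N × N') ∧ x = K₀.mk N}

variable [IsArtinianRing Λ]

/-- The (chosen) source of the projective cover of `M`. -/
noncomputable def projCover (M : FGModuleCat.{u} Λ) : FGModuleCat.{u} Λ :=
  (exists_isProjectiveCover M).choose

/-- The (chosen) projective cover `P(M) → M`. -/
noncomputable def projCoverMap (M : FGModuleCat.{u} Λ) : projCover M →ₗ[Λ] M :=
  (exists_isProjectiveCover M).choose_spec.choose

theorem isProjectiveCover_projCoverMap (M : FGModuleCat.{u} Λ) :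
    IsProjectiveCover (projCoverMap M) :=
  (exists_isProjectiveCover M).choose_spec.choose_spec

/-- The syzygy `Ω M`: the kernel of the projective cover of `M`. The `n`-th syzygy is
`syzygy^[n] M`. -/
noncomputable def syzygy (M : FGModuleCat.{u} Λ) : FGModuleCat.{u} Λ :=
  FGModuleCat.of Λ (LinearMap.ker (projCoverMap M))

theorem nonempty_syzygy_equiv_prod {M M' M'' : FGModuleCat.{u} Λ} (e : M ≃ₗ[Λ] M' × M'') :
    Nonempty (syzygy M ≃ₗ[Λ] syzygy M' × syzygy M'') := by
  obtain ⟨e1⟩ := (isProjectiveCover_projCoverMap M).nonempty_ker_equiv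
    ((isProjectiveCover_projCoverMap M').prodMap (isProjectiveCover_projCoverMap M'')) e
  exact ⟨e1 ≪≫ₗ kerProdMapEquiv _ _⟩

theorem projective_syzygy_of_projective {P : FGModuleCat.{u} Λ} (h : Module.Projective Λ P) :
    Module.Projective Λ (syzygy P) := by
  obtain ⟨e⟩ := (isProjectiveCover_projCoverMap P).nonempty_ker_equiv
    (isProjectiveCover_id (Λ := Λ) (P := P)) (LinearEquiv.refl Λ P)
  have : Subsingleton (LinearMap.ker (LinearMap.id : P →ₗ[Λ] P)) := by
    rw [LinearMap.ker_id]; infer_instance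
  exact Module.Projective.of_equiv e.symm

/-- The endomorphism `Ω̄` of `K₀` induced by `Ω`: it sends `[M]` to `[Ω M]`. -/
noncomputable def syzygyHom (Λ : Type u) [Ring Λ] [IsArtinianRing Λ] : K₀ Λ →+ K₀ Λ :=
  QuotientAddGroup.lift _ (FreeAbelianGroup.lift fun M => K₀.mk (syzygy M)) (by
    rw [AddSubgroup.closure_le]
    rintro _ (⟨M, M', M'', ⟨e⟩, rfl⟩ | ⟨P, hP, rfl⟩)
    · obtain ⟨e'⟩ := nonempty_syzygy_equiv_prod e
      simp [AddMonoidHom.mem_ker, K₀.mk_eq_add e']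
    · simp [AddMonoidHom.mem_ker, K₀.mk_eq_zero (projective_syzygy_of_projective hP)])

theorem syzygyHom_mk (M : FGModuleCat.{u} Λ) : syzygyHom Λ (K₀.mk M) = K₀.mk (syzygy M) := by
  simp [syzygyHom, K₀.mk]

/-- The Igusa-Todorov function `φ`: the least `l` such that `Ω̄` is injective on
`Ω̄^(l + s) ⟨add M⟩` for all `s ≥ 0`. Such an `l` always exists, because `⟨add M⟩` is a finitely
generated abelian group. -/
noncomputable def phi (M : FGModuleCat.{u} Λ) : ℕ :=
  sInf {l : ℕ | ∀ s : ℕ,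
    Set.InjOn (syzygyHom Λ) ((syzygyHom Λ)^[l + s] '' (addSpan M : Set (K₀ Λ)))}

/-- The Igusa-Todorov function `ψ`: `φ(M)` plus the supremum of the projective dimensions of those
direct summands of `Ω^(φ(M)) M` that have finite projective dimension. -/
noncomputable def psi (M : FGModuleCat.{u} Λ) : ℕ∞ :=
  phi M + sSup {d : ℕ∞ | ∃ N N' : FGModuleCat.{u} Λ,
    Nonempty (syzygy^[phi M] M ≃ₗ[Λ] N × N') ∧ pd N < ⊤ ∧ d = pd N}

end Functions

end IgusaTodorov

/-!
The proof reduces both inequalities to one statement, `pd_le_psi_add_one`: if `0 → A → B → C → 0` is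
exact, `A` is a direct summand of `W`, the class of `B` lies in `⟨add W⟩` and `pd C < ∞`, then
`pd C ≤ ψ(W) + 1`. It is applied to the sequences `0 → Ω M'' → M' × P(M'') → M → 0` and
`0 → Ω M → L → M' → 0`, where `L` is the kernel of the composite `P(M) → M → M''`, so that
`[L] = [Ω M'']` in `K₀` (`mk_ker_eq_mk_syzygy`).

For the reduced statement, the horseshoe lemma gives sequences `0 → Ωⁿ A → Bₙ → Ωⁿ C → 0` with
`[Bₙ] = Ω̄ⁿ[B]`. If `n ≥ pd C`, the last term is projective and the sequence splits, hence
`Ω̄ⁿ[A] = Ω̄ⁿ[B]`; by definition of `φ` the same equality holds already for `n = φ(W)`. That the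
minimum defining `φ(W)` exists is where finite generation of `⟨add W⟩` enters
(`exists_injOn_iterate_image`, `addSpan_fg`). Equality of classes in `K₀` means stable equivalence
(`StablyEquiv.of_mk_eq_mk`), which rests on the cancellation of finitely generated modules from
direct sums. So with `X = Ω^φ(W) A` and `D = Ω^φ(W) C` there is, up to projective summands, an exact
sequence `0 → X → X × P → D → 0`. Its first map gives an endomorphism `f` of `X`. The Fitting
decomposition splits off the summand `Y` of `X` on which `f` is nilpotent, and the long exact
sequence of `Ext` shows that `pd Y < ∞` and `pd D ≤ pd Y + 1`
(`exists_idempotent_hasProjectiveDimensionLT`). Since `Y` is a summand of `Ω^φ(W) W`, the bound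
`pd C ≤ φ(W) + pd D ≤ ψ(W) + 1` follows.
-/

namespace IgusaTodorov

/-! ### Fitting's lemma and cancellation of modules with local endomorphism ring -/

section Fitting

variable {Λ : Type*} [Ring Λ] {X Y Z : Type*} [AddCommGroup X] [Module Λ X] [AddCommGroup Y]
  [Module Λ Y] [AddCommGroup Z] [Module Λ Z]

/-- Fitting's lemma: `e` is the projection onto the component of `X` on which `f` is nilpotent, and
`g` inverts a power of `f` on the complementary component. -/
theorem exists_fitting_idempotent [IsArtinian Λ X] [IsNoetherian Λ X] (f : Module.End Λ X) :
    ∃ (n : ℕ) (e g : Module.End Λ X), e * e = e ∧ f ^ (n + 1) * e = 0 ∧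
      g * f ^ (n + 1) = 1 - e ∧ f ^ (n + 1) * g = 1 - e := by
  obtain ⟨k, hk⟩ := Filter.eventually_atTop.1 (LinearMap.eventually_isCompl_ker_pow_range_pow f)
  have hc := hk (k + 1) (Nat.le_succ k)
  set h : Module.End Λ X := f ^ (k + 1) with hh
  let e : Module.End Λ X :=
    (LinearMap.ker h).subtype ∘ₗ Submodule.projectionOnto (LinearMap.ker h) _ hc
  have he_mem : ∀ x, h (e x) = 0 := fun x => (Submodule.projectionOnto (LinearMap.ker h) _ hc x).2
  have he_ker : ∀ x, h x = 0 → e x = x := fun x hx =>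
    congrArg Subtype.val (Submodule.projectionOnto_apply_left hc ⟨x, hx⟩)
  have he_range : ∀ x, e (h x) = 0 := fun x =>
    congrArg Subtype.val (Submodule.projectionOnto_apply_right hc ⟨h x, ⟨x, rfl⟩⟩)
  have hee : ∀ x, e (e x) = e x := fun x => he_ker _ (he_mem x)
  -- `h + e` is `h` on its range and the identity on its kernel, hence bijective; `g` is its inverse.
  have hinj : Function.Injective (h + e) := by
    rw [injective_iff_map_eq_zero]
    intro x hx
    rw [LinearMap.add_apply] at hx
    have h1 : e x = 0 := by
      have := congrArg e hx
      rwa [map_add, he_range, hee, zero_add, map_zero] at this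
    rw [h1, add_zero] at hx
    rw [← he_ker x hx, h1]
  let k' : X ≃ₗ[Λ] X := LinearEquiv.ofBijective (h + e)
    (IsArtinian.bijective_of_injective_endomorphism _ hinj)
  have hk' : ∀ x, k' x = h x + e x := fun x => rfl
  have hg : ∀ x, k'.symm (e x) = e x := by
    intro x
    rw [LinearEquiv.symm_apply_eq, hk', he_mem, hee, zero_add]
  have hge : ∀ x, e (k'.symm x) = e x := by
    intro x
    obtain ⟨y, rfl⟩ := k'.surjective x
    rw [LinearEquiv.symm_apply_apply, hk', map_add, he_range, hee, zero_add]
  refine ⟨k, e, k'.symm, ?_, ?_, ?_, ?_⟩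
  · ext x; exact hee x
  · ext x; exact he_mem x
  · ext x
    change k'.symm (h x) = x - e x
    rw [LinearEquiv.symm_apply_eq, map_sub, hk', hk', he_mem, hee]
    abel
  · ext x
    change h (k'.symm x) = x - e x
    rw [eq_sub_iff_add_eq]
    conv_lhs => rw [← hge x, ← hk', LinearEquiv.apply_symm_apply]

/-- The endomorphism ring of an indecomposable module of finite length is local. Here `X` may also be
zero. -/
theorem isUnit_or_isUnit_of_add_eq_one [IsArtinian Λ X] [IsNoetherian Λ X]
    (hX : ∀ U V : Submodule Λ X, IsCompl U V → U = ⊥ ∨ V = ⊥) {a b : Module.End Λ X}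
    (hab : a + b = 1) : IsUnit a ∨ IsUnit b := by
  obtain ⟨n, e, g, hee, hfe, hgf, hfg⟩ := exists_fitting_idempotent a
  rcases hX _ _ (LinearMap.IsIdempotentElem.isCompl (f := e) hee) with h | h
  · rw [LinearMap.range_eq_bot] at h
    left
    rw [h, sub_zero] at hgf hfg
    exact (isUnit_pow_succ_iff (n := n)).1 ⟨⟨_, g, hfg, hgf⟩, rfl⟩
  · right
    have he : e = 1 := by
      ext x
      have : e x - x ∈ LinearMap.ker e := by
        rw [LinearMap.mem_ker, map_sub, sub_eq_zero]
        exact LinearMap.congr_fun hee x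
      rw [h, Submodule.mem_bot, sub_eq_zero] at this
      exact this
    rw [he, mul_one] at hfe
    rw [← eq_sub_iff_add_eq'] at hab
    rw [hab]
    exact IsNilpotent.isUnit_one_sub ⟨_, hfe⟩

/-- Elimination: if the entry `Z → Z` of an isomorphism `X × Z ≃ Y × Z` is invertible, its Schur
complement is an isomorphism `X ≃ Y`. -/
theorem nonempty_equiv_of_bijective_corner (φ : (X × Z) ≃ₗ[Λ] Y × Z)
    (hd : Function.Bijective fun z : Z => (φ (0, z)).2) : Nonempty (X ≃ₗ[Λ] Y) := by
  let d : Z ≃ₗ[Λ] Z := LinearEquiv.ofBijective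
    (LinearMap.snd Λ Y Z ∘ₗ φ.toLinearMap ∘ₗ LinearMap.inr Λ X Z) hd
  let c : X →ₗ[Λ] Z := LinearMap.snd Λ Y Z ∘ₗ φ.toLinearMap ∘ₗ LinearMap.inl Λ X Z
  have key : ∀ x z, (φ (x, z)).2 = c x + d z := by
    intro x z
    have : ((x, z) : X × Z) = (x, 0) + (0, z) := by simp
    rw [this, map_add]
    rfl
  -- The map `s` solves `(φ (x, z)).2 = 0` for `z`.
  let s : X →ₗ[Λ] X × Z := LinearMap.prod LinearMap.id (-(d.symm.toLinearMap ∘ₗ c))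
  have hs : ∀ x, (φ (s x)).2 = 0 := by
    intro x
    change (φ (x, -(d.symm (c x)))).2 = 0
    rw [key]; simp
  refine ⟨LinearEquiv.ofLinearMap (LinearMap.fst Λ Y Z ∘ₗ φ.toLinearMap ∘ₗ s)
    (LinearMap.fst Λ X Z ∘ₗ φ.symm.toLinearMap ∘ₗ LinearMap.inl Λ Y Z) ?_ ?_⟩
  · ext y
    change (φ (s (φ.symm (y, 0)).1)).1 = y
    have h2 : s (φ.symm (y, 0)).1 = φ.symm (y, 0) := by
      refine Prod.ext rfl ?_
      change -(d.symm (c (φ.symm (y, 0)).1)) = (φ.symm (y, 0)).2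
      rw [neg_eq_iff_eq_neg, LinearEquiv.symm_apply_eq, map_neg, ← add_eq_zero_iff_eq_neg, ← key]
      simp
    rw [h2]; simp
  · ext x
    change (φ.symm ((φ (s x)).1, 0)).1 = x
    have : ((φ (s x)).1, (0 : Z)) = φ (s x) := Prod.ext rfl (hs x).symm
    rw [this, LinearEquiv.symm_apply_apply]
    rfl

/-- Cancellation of a module with local endomorphism ring. -/
theorem nonempty_equiv_of_prod_equiv [IsNoetherian Λ Z]
    (hZ : ∀ a b : Module.End Λ Z, a + b = 1 → IsUnit a ∨ IsUnit b)
    (φ : (X × Z) ≃ₗ[Λ] Y × Z) : Nonempty (X ≃ₗ[Λ] Y) := by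
  let c : X →ₗ[Λ] Z := LinearMap.snd Λ Y Z ∘ₗ φ.toLinearMap ∘ₗ LinearMap.inl Λ X Z
  let d : Module.End Λ Z := LinearMap.snd Λ Y Z ∘ₗ φ.toLinearMap ∘ₗ LinearMap.inr Λ X Z
  let b' : Z →ₗ[Λ] X := LinearMap.fst Λ X Z ∘ₗ φ.symm.toLinearMap ∘ₗ LinearMap.inr Λ Y Z
  let d' : Module.End Λ Z := LinearMap.snd Λ X Z ∘ₗ φ.symm.toLinearMap ∘ₗ LinearMap.inr Λ Y Z
  have key : ∀ x z, (φ (x, z)).2 = c x + d z := by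
    intro x z
    have : ((x, z) : X × Z) = (x, 0) + (0, z) := by simp
    rw [this, map_add]
    rfl
  have hsum : d * d' + c ∘ₗ b' = 1 := by
    ext z
    change d (d' z) + c (b' z) = z
    rw [add_comm, ← key]
    change (φ (φ.symm (0, z))).2 = z
    simp
  rcases hZ _ _ hsum with h | h
  · refine nonempty_equiv_of_bijective_corner φ ?_
    have hs : Function.Surjective d := by
      intro z
      obtain ⟨w, rfl⟩ := ((Module.End.isUnit_iff _).1 h).2 z
      exact ⟨_, rfl⟩
    exact IsNoetherian.bijective_of_surjective_endomorphism d hs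
  -- In the second case `t` is chosen with `d + c b' t = 1`, so that a shear of `X × Z` turns the
  -- entry `d` into the identity.
  · obtain ⟨v, hv⟩ := h
    let t : Module.End Λ Z := (↑v⁻¹ : Module.End Λ Z) * (1 - d)
    have ht : ∀ z, c (b' (t z)) = z - d z := by
      intro z
      have h1 : (v : Module.End Λ Z) * t = 1 - d := by simp [t]
      rw [hv] at h1
      exact LinearMap.congr_fun h1 z
    let σ : (X × Z) ≃ₗ[Λ] X × Z := LinearEquiv.ofLinearMap
      (LinearMap.prod (LinearMap.fst Λ X Z + b' ∘ₗ t ∘ₗ LinearMap.snd Λ X Z) (LinearMap.snd Λ X Z))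
      (LinearMap.prod (LinearMap.fst Λ X Z - b' ∘ₗ t ∘ₗ LinearMap.snd Λ X Z) (LinearMap.snd Λ X Z))
      (by ext <;> simp) (by ext <;> simp)
    refine nonempty_equiv_of_bijective_corner (σ ≪≫ₗ φ) ?_
    have : (fun z : Z => ((σ ≪≫ₗ φ) (0, z)).2) = id := by
      funext z
      change (φ (0 + b' (t z), z)).2 = z
      rw [key, zero_add, ht]; abel
    rw [this]
    exact Function.bijective_id

theorem nonempty_equiv_prod_of_leftInverse {i : Y →ₗ[Λ] X} {p : X →ₗ[Λ] Y}
    (h : p ∘ₗ i = LinearMap.id) : Nonempty (X ≃ₗ[Λ] Y × LinearMap.ker p) := by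
  have h' : ∀ y, p (i y) = y := LinearMap.congr_fun h
  refine ⟨LinearEquiv.ofLinearMap
    (LinearMap.prod p (LinearMap.codRestrict _ (LinearMap.id - i ∘ₗ p) ?_))
    (LinearMap.coprod i (LinearMap.ker p).subtype) ?_ ?_⟩
  · intro x; simp [h']
  · apply LinearMap.ext
    rintro ⟨y, z, hz⟩
    have hz' : p z = 0 := hz
    ext <;> simp [h', hz']
  · ext x; simp

end Fitting

/-! ### Direct summands -/

section Summands

variable {Λ : Type u} [Ring Λ]

/-- `N` is (isomorphic to) a direct summand of `M`. -/
def IsSummand (N M : FGModuleCat.{u} Λ) : Prop :=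
  ∃ N' : FGModuleCat.{u} Λ, Nonempty (M ≃ₗ[Λ] N × N')

theorem IsSummand.exists_leftInverse {N M : FGModuleCat.{u} Λ} (h : IsSummand N M) :
    ∃ (i : N →ₗ[Λ] M) (p : M →ₗ[Λ] N), p ∘ₗ i = LinearMap.id := by
  obtain ⟨N', ⟨e⟩⟩ := h
  refine ⟨e.symm.toLinearMap ∘ₗ LinearMap.inl Λ N N', LinearMap.fst Λ N N' ∘ₗ e.toLinearMap, ?_⟩
  ext x; simp

/-- An indecomposable direct summand of an indecomposable module is the whole module. -/
theorem IsIndecomposable.nonempty_equiv {N M : FGModuleCat.{u} Λ} (hN : IsIndecomposable N)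
    (hM : IsIndecomposable M) (h : IsSummand N M) : Nonempty (M ≃ₗ[Λ] N) := by
  obtain ⟨i, p, hp⟩ := h.exists_leftInverse
  have hp' : ∀ x, p (i x) = x := LinearMap.congr_fun hp
  refine ⟨LinearEquiv.ofBijective p ⟨?_, fun x => ⟨i x, hp' x⟩⟩⟩
  have hid : IsIdempotentElem (i ∘ₗ p : Module.End Λ M) := by
    ext x
    change i (p (i (p x))) = i (p x)
    rw [hp']
  rcases hM.2 _ _ (LinearMap.IsIdempotentElem.isCompl hid) with h0 | h0
  · rw [LinearMap.range_eq_bot] at h0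
    have := hN.1
    obtain ⟨x, hx⟩ := exists_ne (0 : N)
    refine (hx ?_).elim
    have := LinearMap.congr_fun h0 (i x)
    change i (p (i x)) = 0 at this
    rw [hp'] at this
    rw [← hp' x, this, map_zero]
  · rw [← LinearMap.ker_eq_bot, eq_bot_iff, ← h0]
    exact LinearMap.ker_le_ker_comp p i

end Summands

/-! ### Decomposition into indecomposable modules -/

section Induction

variable {Λ : Type u} [Ring Λ] [IsArtinianRing Λ]

/-- Every finitely generated module is a finite direct sum of indecomposable ones; this is stated
as an induction principle. -/
theorem FGModuleCat.induction_indecomposable {p : FGModuleCat.{u} Λ → Prop}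
    (zero : ∀ M : FGModuleCat.{u} Λ, Subsingleton M → p M)
    (indecomposable : ∀ M : FGModuleCat.{u} Λ, IsIndecomposable M → p M)
    (prod : ∀ M U V : FGModuleCat.{u} Λ, (M ≃ₗ[Λ] U × V) → p U → p V → p M)
    (M : FGModuleCat.{u} Λ) : p M := by
  have main : ∀ U : Submodule Λ M, p (FGModuleCat.of Λ U) := by
    intro U
    induction U using WellFoundedLT.induction with
    | ind U ih =>
    by_cases hU : Subsingleton U
    · exact zero _ hU
    rw [not_subsingleton_iff_nontrivial] at hU
    by_cases hind : IsIndecomposable (FGModuleCat.of Λ U)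
    · exact indecomposable _ hind
    have : ∃ V W : Submodule Λ U, IsCompl V W ∧ V ≠ ⊥ ∧ W ≠ ⊥ := by
      by_contra! hcon
      exact hind ⟨hU, fun V W h => or_iff_not_imp_left.2 (hcon V W h)⟩
    obtain ⟨V, W, hVW, hV, hW⟩ := this
    have hlt : ∀ V' : Submodule Λ U, V' ≠ ⊤ → V'.map U.subtype < U := by
      intro V' hV'
      refine lt_of_le_of_ne (Submodule.map_subtype_le U V') fun heq => hV' ?_
      exact Submodule.map_injective_of_injective U.injective_subtype
        (heq.trans (Submodule.map_subtype_top U).symm)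
    refine prod _ (FGModuleCat.of Λ (V.map U.subtype)) (FGModuleCat.of Λ (W.map U.subtype)) ?_
      (ih _ (hlt V fun h => hW ?_)) (ih _ (hlt W fun h => hV ?_))
    · exact (Submodule.prodEquivOfIsCompl V W hVW).symm ≪≫ₗ
        (Submodule.equivMapOfInjective _ U.injective_subtype V).prodCongr
          (Submodule.equivMapOfInjective _ U.injective_subtype W)
    · simpa [h] using hVW.disjoint
    · simpa [h] using hVW.disjoint
  refine prod M (FGModuleCat.of Λ (⊤ : Submodule Λ M)) (FGModuleCat.of Λ (⊥ : Submodule Λ M))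
    ?_ (main _) (main _)
  exact (Submodule.prodEquivOfIsCompl ⊤ ⊥ isCompl_top_bot).symm

theorem IsIndecomposable.isUnit_or_isUnit {N : FGModuleCat.{u} Λ} (hN : IsIndecomposable N)
    {a b : Module.End Λ N} (hab : a + b = 1) : IsUnit a ∨ IsUnit b :=
  isUnit_or_isUnit_of_add_eq_one hN.2 hab

/-- Finitely generated modules can be cancelled from direct sums. -/
theorem nonempty_equiv_of_prod_equiv_prod (Z : FGModuleCat.{u} Λ) :
    ∀ X Y : FGModuleCat.{u} Λ, Nonempty ((X × Z) ≃ₗ[Λ] Y × Z) → Nonempty (X ≃ₗ[Λ] Y) := by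
  induction Z using FGModuleCat.induction_indecomposable with
  | zero Z hZ =>
    rintro X Y ⟨φ⟩
    exact nonempty_equiv_of_prod_equiv (fun a b _ => Or.inl ⟨1, Subsingleton.elim _ _⟩) φ
  | indecomposable Z hZ =>
    rintro X Y ⟨φ⟩
    exact nonempty_equiv_of_prod_equiv (fun a b h => hZ.isUnit_or_isUnit h) φ
  | prod Z U V e hU hV =>
    rintro X Y ⟨φ⟩
    refine hU X Y (hV (FGModuleCat.of Λ (X × U)) (FGModuleCat.of Λ (Y × U)) ⟨?_⟩)
    exact LinearEquiv.prodAssoc Λ X U V ≪≫ₗ (LinearEquiv.refl Λ X).prodCongr e.symm ≪≫ₗ φ ≪≫ₗ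
      (LinearEquiv.refl Λ Y).prodCongr e ≪≫ₗ (LinearEquiv.prodAssoc Λ Y U V).symm

theorem IsSummand.of_leftInverse {N M : FGModuleCat.{u} Λ} {i : N →ₗ[Λ] M} {p : M →ₗ[Λ] N}
    (h : p ∘ₗ i = LinearMap.id) : IsSummand N M :=
  ⟨FGModuleCat.of Λ (LinearMap.ker p), nonempty_equiv_prod_of_leftInverse h⟩

theorem IsSummand.trans {N M L : FGModuleCat.{u} Λ} (h : IsSummand N M) (h' : IsSummand M L) :
    IsSummand N L := by
  obtain ⟨i, p, hp⟩ := h.exists_leftInverse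
  obtain ⟨j, q, hq⟩ := h'.exists_leftInverse
  refine IsSummand.of_leftInverse (i := j ∘ₗ i) (p := p ∘ₗ q) ?_
  ext x
  change p (q (j (i x))) = x
  rw [show q (j (i x)) = i x from LinearMap.congr_fun hq _]
  exact LinearMap.congr_fun hp x

/-- The identity of `N` is the sum of its factorizations through `U` and `V`, and since `End N` is
local, one of these is invertible. -/
theorem IsIndecomposable.isSummand_or {N M U V : FGModuleCat.{u} Λ} (hN : IsIndecomposable N)
    (h : IsSummand N M) (e : M ≃ₗ[Λ] U × V) : IsSummand N U ∨ IsSummand N V := by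
  obtain ⟨i, p, hp⟩ := h.exists_leftInverse
  let iU : N →ₗ[Λ] U := LinearMap.fst Λ U V ∘ₗ e.toLinearMap ∘ₗ i
  let iV : N →ₗ[Λ] V := LinearMap.snd Λ U V ∘ₗ e.toLinearMap ∘ₗ i
  let pU : U →ₗ[Λ] N := p ∘ₗ e.symm.toLinearMap ∘ₗ LinearMap.inl Λ U V
  let pV : V →ₗ[Λ] N := p ∘ₗ e.symm.toLinearMap ∘ₗ LinearMap.inr Λ U V
  have hsum : (pU ∘ₗ iU : Module.End Λ N) + pV ∘ₗ iV = 1 := by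
    ext x
    change p (e.symm ((e (i x)).1, 0)) + p (e.symm (0, (e (i x)).2)) = x
    rw [← map_add, ← map_add]
    simpa using LinearMap.congr_fun hp x
  rcases hN.isUnit_or_isUnit hsum with ⟨a, ha⟩ | ⟨a, ha⟩
  · left
    refine IsSummand.of_leftInverse (i := iU) (p := (↑a⁻¹ : Module.End Λ N) ∘ₗ pU) ?_
    rw [LinearMap.comp_assoc, ← ha]
    exact a.inv_mul
  · right
    refine IsSummand.of_leftInverse (i := iV) (p := (↑a⁻¹ : Module.End Λ N) ∘ₗ pV) ?_
    rw [LinearMap.comp_assoc, ← ha]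
    exact a.inv_mul

end Induction

/-! ### Stable equivalence and `K₀` -/

section StableGroup

variable {Λ : Type u} [Ring Λ]

/-- Two finitely generated modules are stably equivalent if they become isomorphic after adding
finitely generated projective modules. -/
def StablyEquiv (X Y : FGModuleCat.{u} Λ) : Prop :=
  ∃ P Q : FGModuleCat.{u} Λ, Module.Projective Λ P ∧ Module.Projective Λ Q ∧
    Nonempty ((X × P) ≃ₗ[Λ] Y × Q)

theorem StablyEquiv.of_equiv {X Y : FGModuleCat.{u} Λ} (e : X ≃ₗ[Λ] Y) : StablyEquiv X Y :=
  ⟨FGModuleCat.of Λ PUnit, FGModuleCat.of Λ PUnit, inferInstance, inferInstance,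
    ⟨e.prodCongr (LinearEquiv.refl Λ _)⟩⟩

theorem StablyEquiv.symm {X Y : FGModuleCat.{u} Λ} (h : StablyEquiv X Y) : StablyEquiv Y X := by
  obtain ⟨P, Q, hP, hQ, ⟨e⟩⟩ := h
  exact ⟨Q, P, hQ, hP, ⟨e.symm⟩⟩

theorem StablyEquiv.trans {X Y Z : FGModuleCat.{u} Λ} (h : StablyEquiv X Y)
    (h' : StablyEquiv Y Z) : StablyEquiv X Z := by
  obtain ⟨P, Q, hP, hQ, ⟨e⟩⟩ := h
  obtain ⟨P', Q', hP', hQ', ⟨e'⟩⟩ := h'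
  refine ⟨FGModuleCat.of Λ (P × P'), FGModuleCat.of Λ (Q' × Q), inferInstance, inferInstance, ⟨?_⟩⟩
  exact (LinearEquiv.prodAssoc Λ X P P').symm ≪≫ₗ e.prodCongr (LinearEquiv.refl Λ P') ≪≫ₗ
    LinearEquiv.prodAssoc Λ Y Q P' ≪≫ₗ
    (LinearEquiv.refl Λ Y).prodCongr (LinearEquiv.prodComm Λ Q P') ≪≫ₗ
    (LinearEquiv.prodAssoc Λ Y P' Q).symm ≪≫ₗ e'.prodCongr (LinearEquiv.refl Λ Q) ≪≫ₗ
    LinearEquiv.prodAssoc Λ Z Q' Q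

theorem StablyEquiv.prod {X Y X' Y' : FGModuleCat.{u} Λ} (h : StablyEquiv X Y)
    (h' : StablyEquiv X' Y') :
    StablyEquiv (FGModuleCat.of Λ (X × X')) (FGModuleCat.of Λ (Y × Y')) := by
  obtain ⟨P, Q, hP, hQ, ⟨e⟩⟩ := h
  obtain ⟨P', Q', hP', hQ', ⟨e'⟩⟩ := h'
  refine ⟨FGModuleCat.of Λ (P × P'), FGModuleCat.of Λ (Q × Q'), inferInstance, inferInstance, ⟨?_⟩⟩
  exact LinearEquiv.prodProdProdComm Λ X X' P P' ≪≫ₗ e.prodCongr e' ≪≫ₗ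
    LinearEquiv.prodProdProdComm Λ Y Q Y' Q'

variable (Λ) in
/-- Finitely generated modules up to stable equivalence. -/
def stableSetoid : Setoid (FGModuleCat.{u} Λ) where
  r := StablyEquiv
  iseqv := ⟨fun X => .of_equiv (LinearEquiv.refl Λ X), .symm, .trans⟩

variable (Λ) in
/-- The monoid of stable equivalence classes of finitely generated modules, with addition induced
by the direct sum. -/
def StableMonoid : Type (u + 1) := Quotient (stableSetoid Λ)

/-- The stable equivalence class of a module. -/
def StableMonoid.mk (X : FGModuleCat.{u} Λ) : StableMonoid Λ := Quotient.mk (stableSetoid Λ) X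

theorem StableMonoid.mk_eq_mk {X Y : FGModuleCat.{u} Λ} :
    StableMonoid.mk X = StableMonoid.mk Y ↔ StablyEquiv X Y :=
  Quotient.eq (r := stableSetoid Λ)

instance : Zero (StableMonoid Λ) := ⟨StableMonoid.mk (FGModuleCat.of Λ PUnit)⟩

instance : Add (StableMonoid Λ) :=
  ⟨Quotient.map₂ (fun X Y => FGModuleCat.of Λ (X × Y)) fun _ _ h _ _ h' => h.prod h'⟩

instance : AddCommMonoid (StableMonoid Λ) where
  add_assoc := by
    rintro ⟨X⟩ ⟨Y⟩ ⟨Z⟩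
    exact StableMonoid.mk_eq_mk.2 (.of_equiv (LinearEquiv.prodAssoc Λ X Y Z))
  zero_add := by
    rintro ⟨X⟩
    exact StableMonoid.mk_eq_mk.2 (.of_equiv LinearEquiv.uniqueProd)
  add_zero := by
    rintro ⟨X⟩
    exact StableMonoid.mk_eq_mk.2 (.of_equiv LinearEquiv.prodUnique)
  add_comm := by
    rintro ⟨X⟩ ⟨Y⟩
    exact StableMonoid.mk_eq_mk.2 (.of_equiv (LinearEquiv.prodComm Λ X Y))
  nsmul := nsmulRec

theorem StableMonoid.mk_eq_zero {P : FGModuleCat.{u} Λ} (hP : Module.Projective Λ P) :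
    StableMonoid.mk P = 0 :=
  StableMonoid.mk_eq_mk.2 ⟨FGModuleCat.of Λ PUnit, P, inferInstance, hP,
    ⟨LinearEquiv.prodComm Λ P PUnit.{u + 1}⟩⟩

instance [IsArtinianRing Λ] : IsCancelAdd (StableMonoid Λ) := by
  have : IsRightCancelAdd (StableMonoid Λ) := ⟨by
    rintro ⟨Z⟩ ⟨X⟩ ⟨Y⟩ h
    obtain ⟨P, Q, hP, hQ, ⟨e⟩⟩ := StableMonoid.mk_eq_mk.1 h
    refine StableMonoid.mk_eq_mk.2 ⟨P, Q, hP, hQ, ?_⟩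
    refine nonempty_equiv_of_prod_equiv_prod Z (FGModuleCat.of Λ (X × P))
      (FGModuleCat.of Λ (Y × Q)) ⟨?_⟩
    exact LinearEquiv.prodAssoc Λ X P Z ≪≫ₗ
      (LinearEquiv.refl Λ X).prodCongr (LinearEquiv.prodComm Λ P Z) ≪≫ₗ
      (LinearEquiv.prodAssoc Λ X Z P).symm ≪≫ₗ e ≪≫ₗ LinearEquiv.prodAssoc Λ Y Z Q ≪≫ₗ
      (LinearEquiv.refl Λ Y).prodCongr (LinearEquiv.prodComm Λ Z Q) ≪≫ₗ
      (LinearEquiv.prodAssoc Λ Y Q Z).symm⟩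
  exact AddCommMagma.IsRightCancelAdd.toIsCancelAdd _

/-- Equality in `K₀` is stable equivalence: the stable monoid is cancellative, hence embeds into
its Grothendieck group, which receives a map from `K₀`. -/
theorem StablyEquiv.of_mk_eq_mk [IsArtinianRing Λ] {X Y : FGModuleCat.{u} Λ}
    (h : K₀.mk X = K₀.mk Y) : StablyEquiv X Y := by
  let F : K₀ Λ →+ Algebra.GrothendieckAddGroup (StableMonoid Λ) :=
    QuotientAddGroup.lift _
      (FreeAbelianGroup.lift fun M => Algebra.GrothendieckAddGroup.of (StableMonoid.mk M)) (by
        rw [AddSubgroup.closure_le]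
        rintro _ (⟨M, M', M'', ⟨e⟩, rfl⟩ | ⟨P, hP, rfl⟩)
        · have : StableMonoid.mk M = StableMonoid.mk M' + StableMonoid.mk M'' :=
            StableMonoid.mk_eq_mk.2 (.of_equiv (Y := FGModuleCat.of Λ (M' × M'')) e)
          simp [AddMonoidHom.mem_ker, this]
        · simp [AddMonoidHom.mem_ker, StableMonoid.mk_eq_zero hP])
  have hF : ∀ M, F (K₀.mk M) = Algebra.GrothendieckAddGroup.of (StableMonoid.mk M) := fun M => by
    simp [F, K₀.mk]
  have h' := congrArg F h
  rw [hF, hF] at h'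
  exact StableMonoid.mk_eq_mk.1 (Algebra.GrothendieckAddGroup.of_injective h')

theorem StablyEquiv.mk_eq_mk {X Y : FGModuleCat.{u} Λ} (h : StablyEquiv X Y) :
    K₀.mk X = K₀.mk Y := by
  obtain ⟨P, Q, hP, hQ, ⟨e⟩⟩ := h
  have h1 := K₀.mk_eq_add (M := FGModuleCat.of Λ (X × P)) e
  have h2 := K₀.mk_eq_add (M := FGModuleCat.of Λ (X × P)) (LinearEquiv.refl Λ (X × P))
  rw [h2, K₀.mk_eq_zero hP, K₀.mk_eq_zero hQ, add_zero, add_zero] at h1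
  exact h1

theorem K₀.mk_congr {X Y : FGModuleCat.{u} Λ} (e : X ≃ₗ[Λ] Y) : K₀.mk X = K₀.mk Y :=
  (StablyEquiv.of_equiv e).mk_eq_mk

end StableGroup

/-! ### The function `φ` -/

section Phi

variable {Λ : Type u} [Ring Λ] [IsArtinianRing Λ]

/-- There are only finitely many classes of indecomposable direct summands of a module. -/
theorem finite_mk_indecomposable_summands (M : FGModuleCat.{u} Λ) :
    {x | ∃ N : FGModuleCat.{u} Λ, IsIndecomposable N ∧ IsSummand N M ∧ x = K₀.mk N}.Finite := by
  induction M using FGModuleCat.induction_indecomposable with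
  | zero M hM =>
    convert Set.finite_empty
    rw [Set.eq_empty_iff_forall_notMem]
    rintro _ ⟨N, hN, hNM, -⟩
    obtain ⟨i, p, hp⟩ := hNM.exists_leftInverse
    have : Function.Injective i := Function.LeftInverse.injective (LinearMap.congr_fun hp)
    exact not_subsingleton_iff_nontrivial.2 hN.1 this.subsingleton
  | indecomposable M hM =>
    refine (Set.finite_singleton (K₀.mk M)).subset ?_
    rintro _ ⟨N, hN, hNM, rfl⟩
    obtain ⟨e⟩ := hN.nonempty_equiv hM hNM
    exact K₀.mk_congr e.symm
  | prod M U V e hU hV =>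
    refine (hU.union hV).subset ?_
    rintro _ ⟨N, hN, hNM, rfl⟩
    rcases hN.isSummand_or hNM e with h | h
    · exact Or.inl ⟨N, hN, h, rfl⟩
    · exact Or.inr ⟨N, hN, h, rfl⟩

theorem addSpan_fg (M : FGModuleCat.{u} Λ) : (addSpan M).FG := by
  rw [AddSubgroup.fg_iff]
  refine ⟨_, rfl, (finite_mk_indecomposable_summands M).subset ?_⟩
  rintro _ ⟨N, N', hN, hNM, rfl⟩
  exact ⟨N, hN, ⟨N', hNM⟩, rfl⟩

/-- `⟨add W⟩` contains the classes of all direct summands of `W`, not only of the indecomposable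
ones. -/
theorem mk_mem_addSpan (M : FGModuleCat.{u} Λ) :
    ∀ W : FGModuleCat.{u} Λ, IsSummand M W → K₀.mk M ∈ addSpan W := by
  induction M using FGModuleCat.induction_indecomposable with
  | zero M hM =>
    intro W _
    rw [K₀.mk_eq_zero inferInstance]
    exact zero_mem _
  | indecomposable M hM =>
    rintro W ⟨N', h⟩
    exact AddSubgroup.subset_closure ⟨M, N', hM, h, rfl⟩
  | prod M U V e hU hV =>
    intro W h
    rw [K₀.mk_eq_add e]
    exact add_mem (hU W (IsSummand.trans ⟨V, ⟨e⟩⟩ h))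
      (hV W (IsSummand.trans ⟨U, ⟨e ≪≫ₗ LinearEquiv.prodComm Λ U V⟩⟩ h))

/-- An endomorphism of an abelian group is eventually injective on the iterated images of a
finitely generated subgroup, because the kernels of its powers on the subgroup stabilize. -/
theorem exists_injOn_iterate_image {G : Type*} [AddCommGroup G] (T : G →+ G) {H : AddSubgroup G}
    (hH : H.FG) : ∃ l : ℕ, ∀ s : ℕ, Set.InjOn T (T^[l + s] '' (H : Set G)) := by
  have hfg : AddGroup.FG H := (AddGroup.fg_iff_addSubgroup_fg H).2 hH
  have : Module.Finite ℤ H := Module.Finite.iff_addGroup_fg.2 hfg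
  let L : Module.End ℤ G := T.toIntLinearMap
  have hL : ∀ n x, (L ^ n) x = T^[n] x := fun n x => by
    rw [Module.End.pow_apply]; rfl
  let K : ℕ →o Submodule ℤ H :=
    ⟨fun n => LinearMap.ker ((L ^ n) ∘ₗ (AddSubgroup.toIntSubmodule H).subtype), by
      refine monotone_nat_of_le_succ fun n x hx => ?_
      change (L ^ n) x = 0 at hx
      change (L ^ (n + 1)) x = 0
      rw [pow_succ', Module.End.mul_apply, hx, map_zero]⟩
  obtain ⟨l, hl⟩ := monotone_stabilizes_iff_noetherian.2 (inferInstance : IsNoetherian ℤ H) K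
  refine ⟨l, fun s => ?_⟩
  rintro _ ⟨x, hx, rfl⟩ _ ⟨y, hy, rfl⟩ hxy
  have hmem : (⟨x, hx⟩ - ⟨y, hy⟩ : H) ∈ K (l + s + 1) := by
    change (L ^ (l + s + 1)) (x - y) = 0
    rw [map_sub, hL, hL, Function.iterate_succ_apply', Function.iterate_succ_apply', hxy, sub_self]
  rw [← hl (l + s + 1) (by omega), hl (l + s) (by omega)] at hmem
  change (L ^ (l + s)) (x - y) = 0 at hmem
  rwa [map_sub, hL, hL, sub_eq_zero] at hmem

/-- The natural number `phi M` has its defining property: the set of which it is the infimum is not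
empty, so the junk value `sInf ∅ = 0` does not occur. -/
theorem injOn_iterate_phi (M : FGModuleCat.{u} Λ) (s : ℕ) :
    Set.InjOn (syzygyHom Λ) ((syzygyHom Λ)^[phi M + s] '' (addSpan M : Set (K₀ Λ))) :=
  Nat.sInf_mem (s := {l : ℕ | ∀ s : ℕ,
    Set.InjOn (syzygyHom Λ) ((syzygyHom Λ)^[l + s] '' (addSpan M : Set (K₀ Λ)))})
    (exists_injOn_iterate_image _ (addSpan_fg M)) s

/-- Classes in `⟨add M⟩` that are identified by some power of `Ω̄` are identified by the power with
exponent `φ(M)`. -/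
theorem iterate_phi_eq_of_iterate_eq {M : FGModuleCat.{u} Λ} {x y : K₀ Λ} (hx : x ∈ addSpan M)
    (hy : y ∈ addSpan M) {n : ℕ} (h : (syzygyHom Λ)^[n] x = (syzygyHom Λ)^[n] y) :
    (syzygyHom Λ)^[phi M] x = (syzygyHom Λ)^[phi M] y := by
  have h' : (syzygyHom Λ)^[phi M + n] x = (syzygyHom Λ)^[phi M + n] y := by
    rw [Function.iterate_add_apply, h, ← Function.iterate_add_apply]
  clear h
  induction n with
  | zero => exact h'
  | succ n ih =>
    refine ih (injOn_iterate_phi M n ⟨x, hx, rfl⟩ ⟨y, hy, rfl⟩ ?_)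
    rwa [← add_assoc, Function.iterate_succ_apply', Function.iterate_succ_apply'] at h'

theorem iterate_syzygyHom_mk (M : FGModuleCat.{u} Λ) (n : ℕ) :
    (syzygyHom Λ)^[n] (K₀.mk M) = K₀.mk (syzygy^[n] M) := by
  induction n with
  | zero => rfl
  | succ n ih => rw [Function.iterate_succ_apply', ih, syzygyHom_mk, Function.iterate_succ_apply']

theorem IsSummand.iterate_syzygy {N M : FGModuleCat.{u} Λ} (h : IsSummand N M) (n : ℕ) :
    IsSummand (syzygy^[n] N) (syzygy^[n] M) := by
  induction n with
  | zero => exact h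
  | succ n ih =>
    obtain ⟨N', ⟨e⟩⟩ := ih
    rw [Function.iterate_succ_apply', Function.iterate_succ_apply']
    exact ⟨syzygy N', nonempty_syzygy_equiv_prod e⟩

end Phi

/-! ### Pullback on `Ext` -/

section ExtPullback

open Abelian

variable {Λ : Type u} [Ring Λ] {X Y Z : Type u} [AddCommGroup X] [Module Λ X] [AddCommGroup Y]
  [Module Λ Y] [AddCommGroup Z] [Module Λ Z] (T : ModuleCat.{u} Λ) (i : ℕ)

/-- The map `Extⁱ(Y, T) → Extⁱ(X, T)` induced by a linear map `X → Y`. -/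
noncomputable def extPull (f : X →ₗ[Λ] Y) :
    Ext (ModuleCat.of Λ Y) T i →+ Ext (ModuleCat.of Λ X) T i :=
  (Ext.mk₀ (ModuleCat.ofHom f)).precomp T (zero_add i)

theorem extPull_apply (f : X →ₗ[Λ] Y) (x : Ext (ModuleCat.of Λ Y) T i) :
    extPull T i f x = (Ext.mk₀ (ModuleCat.ofHom f)).comp x (zero_add i) := rfl

theorem extPull_id (x : Ext (ModuleCat.of Λ X) T i) : extPull T i LinearMap.id x = x := by
  rw [extPull_apply, ModuleCat.ofHom_id, Ext.mk₀_id_comp]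

theorem extPull_comp (g : Y →ₗ[Λ] Z) (f : X →ₗ[Λ] Y) (x : Ext (ModuleCat.of Λ Z) T i) :
    extPull T i (g ∘ₗ f) x = extPull T i f (extPull T i g x) := by
  rw [extPull_apply, extPull_apply, extPull_apply, ModuleCat.ofHom_comp, Ext.mk₀_comp_mk₀_assoc]

theorem extPull_add (f g : X →ₗ[Λ] Y) (x : Ext (ModuleCat.of Λ Y) T i) :
    extPull T i (f + g) x = extPull T i f x + extPull T i g x := by
  rw [extPull_apply, extPull_apply, extPull_apply, ← Ext.add_comp, ← Ext.mk₀_add]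
  rfl

theorem extPull_zero (x : Ext (ModuleCat.of Λ Y) T i) :
    extPull T i (0 : X →ₗ[Λ] Y) x = 0 := by
  have := extPull_add T i (0 : X →ₗ[Λ] Y) 0 x
  rwa [add_zero, left_eq_add] at this

variable {T i}

theorem extPull_pow_surjective {f : Module.End Λ X} (h : Function.Surjective (extPull T i f))
    (n : ℕ) : Function.Surjective (extPull T i (f ^ n)) := by
  induction n with
  | zero => exact fun x => ⟨x, extPull_id T i x⟩
  | succ n ih =>
    intro x
    obtain ⟨y, rfl⟩ := h x
    obtain ⟨z, rfl⟩ := ih y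
    exact ⟨z, extPull_comp T i (f ^ n) f z⟩

theorem eq_zero_of_hasProjectiveDimensionLT {m : ℕ}
    (h : HasProjectiveDimensionLT (ModuleCat.of Λ X) m) (hi : m ≤ i)
    (x : Ext (ModuleCat.of Λ X) T i) : x = 0 :=
  x.eq_zero_of_hasProjectiveDimensionLT m hi

theorem eq_zero_of_projective [Module.Projective Λ X] (hi : 1 ≤ i)
    (x : Ext (ModuleCat.of Λ X) T i) : x = 0 :=
  eq_zero_of_hasProjectiveDimensionLT (m := 1)
    (have := (IsProjective.iff_projective X).1 ‹Module.Projective Λ X›; inferInstance) hi x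

end ExtPullback

/-! ### Exact sequences `0 → X → X × P → D → 0` -/

section ShortExact

variable {Λ : Type u} [Ring Λ] {X Y Z : Type u} [AddCommGroup X] [Module Λ X] [AddCommGroup Y]
  [Module Λ Y] [AddCommGroup Z] [Module Λ Z] {f : X →ₗ[Λ] Y} {g : Y →ₗ[Λ] Z}

theorem shortExact_of_exact (hf : Function.Injective f) (hfg : Function.Exact f g)
    (hg : Function.Surjective g) :
    (ModuleCat.shortComplexOfCompEqZero f g hfg.linearMap_comp_eq_zero).ShortExact :=
  ModuleCat.shortComplex_shortExact _ hfg hf hg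

variable {P D : Type u} [AddCommGroup P] [Module Λ P] [AddCommGroup D] [Module Λ D]
  [Module.Projective Λ P]

/-- In positive degrees a map into `X × P`, with `P` projective, acts on `Ext` through its
component in `X`. -/
theorem extPull_eq_of_projective {T : ModuleCat.{u} Λ} {i : ℕ} (hi : 1 ≤ i) (j : Y →ₗ[Λ] X × P)
    (y : Abelian.Ext (ModuleCat.of Λ (X × P)) T i) :
    extPull T i j y =
      extPull T i (LinearMap.fst Λ X P ∘ₗ j) (extPull T i (LinearMap.inl Λ X P) y) := by
  have h1 : j = LinearMap.inl Λ X P ∘ₗ LinearMap.fst Λ X P ∘ₗ j +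
      LinearMap.inr Λ X P ∘ₗ LinearMap.snd Λ X P ∘ₗ j := by
    ext x <;> simp
  conv_lhs => rw [h1]
  rw [extPull_add, extPull_comp, extPull_comp _ _ (LinearMap.inr Λ X P),
    eq_zero_of_projective hi (extPull T i (LinearMap.inr Λ X P) y), map_zero, add_zero]

/-- Let `0 → X → X × P → D → 0` be exact with `P` projective and `D` of finite projective dimension.
By the long exact sequence the endomorphism `f` of `X` given by the first map is surjective on
`Extⁱ(X, -)` for large `i`. On the Fitting component `range e` where `f` is nilpotent this forces
`Extⁱ = 0`; above the projective dimension of `range e`, `f` is bijective on `Extⁱ(X, -)`, which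
bounds the projective dimension of `D`. -/
theorem exists_idempotent_hasProjectiveDimensionLT [IsArtinian Λ X] [IsNoetherian Λ X]
    {j : X →ₗ[Λ] X × P} {q : X × P →ₗ[Λ] D} (hj : Function.Injective j)
    (hjq : Function.Exact j q) (hq : Function.Surjective q) {n : ℕ}
    (hD : HasProjectiveDimensionLT (ModuleCat.of Λ D) n) :
    ∃ e : Module.End Λ X, e * e = e ∧
      (∃ m, HasProjectiveDimensionLT (ModuleCat.of Λ (LinearMap.range e)) m) ∧
      ∀ m, HasProjectiveDimensionLT (ModuleCat.of Λ (LinearMap.range e)) (m + 1) →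
        HasProjectiveDimensionLT (ModuleCat.of Λ D) (m + 2) := by
  have hS := shortExact_of_exact hj hjq hq
  let f : Module.End Λ X := LinearMap.fst Λ X P ∘ₗ j
  have hjf : ∀ (T : ModuleCat.{u} Λ) (i : ℕ), 1 ≤ i → ∀ y, extPull T i j y =
      extPull T i f (extPull T i (LinearMap.inl Λ X P) y) :=
    fun T i hi y => extPull_eq_of_projective hi j y
  obtain ⟨k, e, g, hee, hfe, hgf, hfg⟩ := exists_fitting_idempotent f
  let ι : LinearMap.range e →ₗ[Λ] X := (LinearMap.range e).subtype
  let p : X →ₗ[Λ] LinearMap.range e := e.rangeRestrict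
  have hpι : p ∘ₗ ι = LinearMap.id := by
    ext ⟨_, x, rfl⟩
    exact LinearMap.congr_fun hee x
  have hfι : (f ^ (k + 1)) ∘ₗ ι = 0 := by
    ext ⟨_, x, rfl⟩
    exact LinearMap.congr_fun hfe x
  refine ⟨e, hee, ⟨n + 1, ?_⟩, fun m hm => ?_⟩
  · rw [hasProjectiveDimensionLT_iff]
    intro i hi T x
    have hsurj : Function.Surjective (extPull T i f) := by
      intro y
      obtain ⟨z, hz⟩ := Abelian.Ext.contravariant_sequence_exact₁ hS T (n₁ := 1 + i) y rfl
        (eq_zero_of_hasProjectiveDimensionLT hD (by omega) _)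
      exact ⟨_, (hjf T i (by omega) z).symm.trans hz⟩
    obtain ⟨z, hz⟩ := extPull_pow_surjective hsurj (k + 1) (extPull T i p x)
    rw [← extPull_id T i x, ← hpι, extPull_comp, ← hz, ← extPull_comp, hfι, extPull_zero]
  · have hsplit : ∀ (T : ModuleCat.{u} Λ) (i : ℕ), m + 1 ≤ i → ∀ x,
        extPull T i (1 - e) x = x := by
      intro T i hi x
      have h1 : extPull T i e x = 0 := by
        change extPull T i (ι ∘ₗ p) x = 0
        rw [extPull_comp, eq_zero_of_hasProjectiveDimensionLT hm hi (extPull T i ι x), map_zero]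
      have h2 := extPull_add T i (1 - e) e x
      rw [h1, add_zero, sub_add_cancel] at h2
      rw [← h2]
      exact extPull_id T i x
    have hinj : ∀ (T : ModuleCat.{u} Λ) (i : ℕ), m + 1 ≤ i → ∀ x, extPull T i f x = 0 → x = 0 := by
      intro T i hi x hx
      rw [← hsplit T i hi x, ← hfg, pow_succ', mul_assoc]
      change extPull T i (f ∘ₗ (f ^ k * g)) x = 0
      rw [extPull_comp, hx, map_zero]
    have hsurj : ∀ (T : ModuleCat.{u} Λ) (i : ℕ), m + 1 ≤ i →
        Function.Surjective (extPull T i f) := by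
      intro T i hi x
      refine ⟨extPull T i (g * f ^ k) x, ?_⟩
      rw [← extPull_comp]
      change extPull T i (g * f ^ k * f) x = x
      rw [mul_assoc, ← pow_succ, hgf, hsplit T i hi]
    rw [hasProjectiveDimensionLT_iff]
    intro i hi T x
    have h0 : extPull T i q x = 0 := by
      have h1 : extPull T i f (extPull T i (LinearMap.inl Λ X P) (extPull T i q x)) = 0 := by
        rw [← hjf T i (by omega), ← extPull_comp, hjq.linearMap_comp_eq_zero, extPull_zero]
      have h2 := extPull_eq_of_projective (by omega) (LinearMap.id : X × P →ₗ[Λ] X × P)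
        (extPull T i q x)
      rwa [extPull_id, hinj T i (by omega) _ h1, map_zero] at h2
    obtain ⟨z, rfl⟩ := Abelian.Ext.contravariant_sequence_exact₃ hS T x h0
      (n₀ := i - 1) (by omega)
    obtain ⟨w, rfl⟩ := hsurj T (i - 1) (by omega) z
    have hw : extPull T (i - 1) f w =
        extPull T (i - 1) j (extPull T (i - 1) (LinearMap.fst Λ X P) w) :=
      extPull_comp T (i - 1) (LinearMap.fst Λ X P) j w
    rw [hw]
    exact hS.extClass_comp_assoc _

end ShortExact

/-! ### Projective dimension -/

section ProjectiveDimension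

variable {Λ : Type u} [Ring Λ]

/-- Since `n` is a natural number, the value of `pd` at the zero module (`0` instead of `-∞`) makes no
difference here. -/
theorem pd_le_iff (M : FGModuleCat.{u} Λ) (n : ℕ) :
    pd M ≤ n ↔ HasProjectiveDimensionLT (ModuleCat.of Λ M) (n + 1) := by
  have h := projectiveDimension_le_iff M.obj n
  refine Iff.trans ?_ h
  rw [pd, WithBot.unbotD_le_iff (fun _ => zero_le)]
  rfl

theorem pd_lt_top_of_hasProjectiveDimensionLT {M : FGModuleCat.{u} Λ} {n : ℕ}
    (h : HasProjectiveDimensionLT (ModuleCat.of Λ M) n) : pd M < ⊤ :=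
  ((pd_le_iff M n).2 (hasProjectiveDimensionLT_of_ge _ n _ (Nat.le_succ n))).trans_lt
    (ENat.natCast_lt_top n)

theorem hasProjectiveDimensionLT_prod {X Y : Type u} [AddCommGroup X] [Module Λ X] [AddCommGroup Y]
    [Module Λ Y] {n : ℕ} (hX : HasProjectiveDimensionLT (ModuleCat.of Λ X) n)
    (hY : HasProjectiveDimensionLT (ModuleCat.of Λ Y) n) :
    HasProjectiveDimensionLT (ModuleCat.of Λ (X × Y)) n :=
  (shortExact_of_exact LinearMap.inl_injective Function.Exact.inl_snd
    LinearMap.snd_surjective).hasProjectiveDimensionLT_X₂ n hX hY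

theorem hasProjectiveDimensionLT_of_leftInverse {X Y : Type u} [AddCommGroup X] [Module Λ X]
    [AddCommGroup Y] [Module Λ Y] {n : ℕ} {i : X →ₗ[Λ] Y} {p : Y →ₗ[Λ] X}
    (h : p ∘ₗ i = LinearMap.id) (hY : HasProjectiveDimensionLT (ModuleCat.of Λ Y) n) :
    HasProjectiveDimensionLT (ModuleCat.of Λ X) n :=
  Retract.hasProjectiveDimensionLT
    ⟨ModuleCat.ofHom i, ModuleCat.ofHom p, by rw [← ModuleCat.ofHom_comp, h]; rfl⟩ n

variable [IsArtinianRing Λ]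

theorem hasProjectiveDimensionLT_syzygy_iff (M : FGModuleCat.{u} Λ) (n : ℕ) :
    HasProjectiveDimensionLT (ModuleCat.of Λ M) (n + 2) ↔
      HasProjectiveDimensionLT (ModuleCat.of Λ (syzygy M)) (n + 1) :=
  (LinearMap.shortExact_shortComplexKer
    (isProjectiveCover_projCoverMap M).surjective).hasProjectiveDimensionLT_X₃_iff n
      ((IsProjective.iff_projective _).1 (isProjectiveCover_projCoverMap M).projective)

theorem hasProjectiveDimensionLT_iterate_syzygy_iff (M : FGModuleCat.{u} Λ) (k n : ℕ) :
    HasProjectiveDimensionLT (ModuleCat.of Λ M) (n + k + 1) ↔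
      HasProjectiveDimensionLT (ModuleCat.of Λ ↑(syzygy^[k] M)) (n + 1) := by
  induction k generalizing n with
  | zero => rfl
  | succ k ih =>
    rw [Function.iterate_succ_apply', ← hasProjectiveDimensionLT_syzygy_iff, ← ih (n + 1)]
    rw [show n + (k + 1) + 1 = n + 1 + k + 1 by omega]

/-- If the first two terms of a short exact sequence have the same class in `K₀` and the third has
finite projective dimension, the latter is at most one more than that of some direct summand of the
first term of finite projective dimension. -/
theorem exists_isSummand_pd_le {X B D : FGModuleCat.{u} Λ} {f : X →ₗ[Λ] B} {g : B →ₗ[Λ] D}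
    (hf : Function.Injective f) (hfg : Function.Exact f g) (hg : Function.Surjective g)
    (hXB : K₀.mk X = K₀.mk B) {n : ℕ} (hD : HasProjectiveDimensionLT (ModuleCat.of Λ D) n) :
    ∃ Y : FGModuleCat.{u} Λ, IsSummand Y X ∧ pd Y < ⊤ ∧
      ∀ m : ℕ, pd Y ≤ m → HasProjectiveDimensionLT (ModuleCat.of Λ D) (m + 2) := by
  obtain ⟨P, Q, hP, hQ, ⟨ε⟩⟩ := StablyEquiv.of_mk_eq_mk hXB
  have hQ1 : HasProjectiveDimensionLT (ModuleCat.of Λ Q) 1 :=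
    projective_iff_hasProjectiveDimensionLT_one.1 ((IsProjective.iff_projective Q).1 hQ)
  let j : X →ₗ[Λ] X × P := ε.symm.toLinearMap ∘ₗ LinearMap.inl Λ B Q ∘ₗ f
  let q : X × P →ₗ[Λ] D × Q := g.prodMap LinearMap.id ∘ₗ ε.toLinearMap
  have hj : Function.Injective j :=
    ε.symm.injective.comp (LinearMap.inl_injective.comp hf)
  have hq : Function.Surjective q :=
    (hg.prodMap Function.surjective_id).comp ε.surjective
  have hjq : Function.Exact j q := by
    intro x
    obtain ⟨⟨b, c⟩, rfl⟩ := ε.symm.surjective x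
    constructor
    · intro h
      have h' : (g b, c) = 0 := by simpa [q] using h
      rw [Prod.mk_eq_zero] at h'
      obtain ⟨a, rfl⟩ := (hfg b).1 h'.1
      exact ⟨a, by simp [j, h'.2]⟩
    · rintro ⟨a, ha⟩
      rw [← ha]
      simp [j, q, hfg.apply_apply_eq_zero]
  obtain ⟨e, hee, ⟨l, hl⟩, he⟩ := exists_idempotent_hasProjectiveDimensionLT hj hjq hq
    (hasProjectiveDimensionLT_prod (n := n + 1)
      (hasProjectiveDimensionLT_of_ge _ n _ (by omega))
      (hasProjectiveDimensionLT_of_ge _ 1 _ (by omega)))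
  refine ⟨FGModuleCat.of Λ (LinearMap.range e), ?_, pd_lt_top_of_hasProjectiveDimensionLT hl,
    fun m hm => ?_⟩
  · refine IsSummand.of_leftInverse (i := (LinearMap.range e).subtype) (p := e.rangeRestrict) ?_
    ext ⟨_, x, rfl⟩
    exact LinearMap.congr_fun hee x
  · exact hasProjectiveDimensionLT_of_leftInverse (LinearMap.fst_comp_inl Λ D Q)
      (he m ((pd_le_iff _ m).1 hm))

end ProjectiveDimension

/-! ### Syzygies of short exact sequences and the bounds -/

section Syzygy

variable {Λ : Type u} [Ring Λ] [IsArtinianRing Λ]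

/-- The class of a syzygy does not depend on the projective module used to form it: the projective
cover splits off from any projective module that maps onto `B`. -/
theorem mk_ker_eq_mk_syzygy {P B : FGModuleCat.{u} Λ} [Module.Projective Λ P] {q : P →ₗ[Λ] B}
    (hq : Function.Surjective q) :
    K₀.mk (FGModuleCat.of Λ (LinearMap.ker q)) = K₀.mk (syzygy B) := by
  have hπ := isProjectiveCover_projCoverMap B
  set π := projCoverMap B
  have := hπ.projective
  obtain ⟨a, ha⟩ := Module.projective_lifting_property π q hπ.surjective
  have ha' : ∀ x, π (a x) = q x := LinearMap.congr_fun ha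
  have hasurj : Function.Surjective a := by
    rw [← LinearMap.range_eq_top]
    apply hπ.superfluous
    rw [eq_top_iff]
    intro y _
    obtain ⟨x, hx⟩ := hq (π y)
    refine Submodule.mem_sup.2 ⟨a x, ⟨x, rfl⟩, y - a x, ?_, by abel⟩
    rw [LinearMap.mem_ker, map_sub, ha', hx, sub_self]
  obtain ⟨s, hs⟩ := Module.projective_lifting_property a LinearMap.id hasurj
  have hs' : ∀ y, a (s y) = y := LinearMap.congr_fun hs
  let p : LinearMap.ker q →ₗ[Λ] LinearMap.ker π := a.restrict fun x hx => by
    rw [LinearMap.mem_ker, ha']; exact hx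
  let i : LinearMap.ker π →ₗ[Λ] LinearMap.ker q := s.restrict fun y hy => by
    rw [LinearMap.mem_ker, ← ha', hs']; exact hy
  have hpi : p ∘ₗ i = LinearMap.id := by
    ext y
    exact hs' y
  obtain ⟨e⟩ := nonempty_equiv_prod_of_leftInverse hpi
  have hproj : Module.Projective Λ (LinearMap.ker p) := by
    refine Module.Projective.of_split ((LinearMap.ker q).subtype ∘ₗ (LinearMap.ker p).subtype)
      (LinearMap.codRestrict _ (LinearMap.codRestrict _ (LinearMap.id - s ∘ₗ a) ?_) ?_) ?_
    · intro x
      rw [LinearMap.mem_ker, ← ha']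
      simp [hs']
    · intro x
      apply Subtype.ext
      change a (x - s (a x)) = 0
      rw [map_sub, hs', sub_self]
    · ext x
      have hx : a x.1.1 = 0 := congrArg Subtype.val x.2
      change x.1.1 - s (a x.1.1) = x.1.1
      rw [hx, map_zero, sub_zero]
  have h := K₀.mk_eq_add (M := FGModuleCat.of Λ (LinearMap.ker q)) (M' := syzygy B)
    (M'' := FGModuleCat.of Λ (LinearMap.ker p)) e
  rwa [K₀.mk_eq_zero (P := FGModuleCat.of Λ (LinearMap.ker p)) hproj, add_zero] at h

/-- The horseshoe lemma: a short exact sequence induces one of syzygies, up to replacing the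
syzygy of the middle term by a module with the same class in `K₀`. -/
theorem exists_shortExact_syzygy {A B C : FGModuleCat.{u} Λ} {f : A →ₗ[Λ] B} {g : B →ₗ[Λ] C}
    (hf : Function.Injective f) (hfg : Function.Exact f g) (hg : Function.Surjective g) :
    ∃ (K : FGModuleCat.{u} Λ) (f' : syzygy A →ₗ[Λ] K) (g' : K →ₗ[Λ] syzygy C),
      Function.Injective f' ∧ Function.Exact f' g' ∧ Function.Surjective g' ∧
        K₀.mk K = K₀.mk (syzygy B) := by
  have hA := isProjectiveCover_projCoverMap A
  have hC := isProjectiveCover_projCoverMap C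
  have := hA.projective
  have := hC.projective
  set α := projCoverMap A
  set γ := projCoverMap C
  obtain ⟨h, hh⟩ := Module.projective_lifting_property g γ hg
  have hh' : ∀ x, g (h x) = γ x := LinearMap.congr_fun hh
  let q : (FGModuleCat.of Λ (projCover A × projCover C)) →ₗ[Λ] B := (f ∘ₗ α).coprod h
  have hq' : ∀ x y, q (x, y) = f (α x) + h y := fun x y => rfl
  have hgq : ∀ x y, g (q (x, y)) = γ y := fun x y => by
    rw [hq', map_add, hfg.apply_apply_eq_zero, zero_add, hh']
  have hq : Function.Surjective q := by
    intro b
    obtain ⟨y, hy⟩ := hC.surjective (g b)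
    obtain ⟨a, ha⟩ := (hfg (b - h y)).1 (by rw [map_sub, hh', hy, sub_self])
    obtain ⟨x, rfl⟩ := hA.surjective a
    exact ⟨(x, y), by rw [hq', ha]; abel⟩
  let f' : LinearMap.ker α →ₗ[Λ] LinearMap.ker q :=
    (LinearMap.inl Λ (projCover A) (projCover C)).restrict fun x hx => by
      have hx' : α x = 0 := hx
      change f (α x) + h 0 = 0
      rw [hx', map_zero, map_zero, add_zero]
  let g' : LinearMap.ker q →ₗ[Λ] LinearMap.ker γ :=
    (LinearMap.snd Λ (projCover A) (projCover C)).restrict fun x hx => by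
      have hx' : q (x.1, x.2) = 0 := hx
      change γ x.2 = 0
      rw [← hgq x.1, hx', map_zero]
  refine ⟨FGModuleCat.of Λ (LinearMap.ker q), f', g', ?_, ?_, ?_, mk_ker_eq_mk_syzygy hq⟩
  · intro x y hxy
    exact Subtype.ext (congrArg (fun z => z.1.1) hxy)
  · rintro ⟨⟨x, y⟩, hxy⟩
    constructor
    · intro h0
      obtain rfl : y = 0 := congrArg Subtype.val h0
      refine ⟨⟨x, hf ?_⟩, rfl⟩
      have hxy' : f (α x) + h 0 = 0 := hxy
      simpa using hxy'
    · rintro ⟨z, hz⟩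
      rw [← hz]
      rfl
  · rintro ⟨y, hy⟩
    have hy' : γ y = 0 := hy
    obtain ⟨a, ha⟩ := (hfg (h y)).1 (by rw [hh', hy'])
    obtain ⟨x, rfl⟩ := hA.surjective a
    refine ⟨⟨(-x, y), ?_⟩, rfl⟩
    change f (α (-x)) + h y = 0
    rw [map_neg, map_neg, ha, neg_add_cancel]

theorem exists_shortExact_iterate_syzygy {A B C : FGModuleCat.{u} Λ} {f : A →ₗ[Λ] B}
    {g : B →ₗ[Λ] C} (hf : Function.Injective f) (hfg : Function.Exact f g)
    (hg : Function.Surjective g) (k : ℕ) :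
    ∃ (K : FGModuleCat.{u} Λ) (f' : ↑(syzygy^[k] A) →ₗ[Λ] K) (g' : K →ₗ[Λ] ↑(syzygy^[k] C)),
      Function.Injective f' ∧ Function.Exact f' g' ∧ Function.Surjective g' ∧
        K₀.mk K = (syzygyHom Λ)^[k] (K₀.mk B) := by
  induction k with
  | zero => exact ⟨B, f, g, hf, hfg, hg, rfl⟩
  | succ k ih =>
    obtain ⟨K, f', g', hf', hfg', hg', hK⟩ := ih
    rw [Function.iterate_succ_apply', Function.iterate_succ_apply', Function.iterate_succ_apply',
      ← hK, syzygyHom_mk]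
    exact exists_shortExact_syzygy hf' hfg' hg'

/-- The Igusa-Todorov inequality for the last term of a short exact sequence. The module `W` stands
in for `A × B`, so that projective summands of `B` need not appear in it. -/
theorem pd_le_psi_add_one {A B C W : FGModuleCat.{u} Λ} {f : A →ₗ[Λ] B}
    {g : B →ₗ[Λ] C} (hf : Function.Injective f) (hfg : Function.Exact f g)
    (hg : Function.Surjective g) (hA : IsSummand A W) (hB : K₀.mk B ∈ addSpan W)
    (hC : pd C < ⊤) : pd C ≤ psi W + 1 := by
  obtain ⟨n, hn⟩ := ENat.ne_top_iff_exists.1 hC.ne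
  have hCn := (pd_le_iff C n).1 hn.symm.le
  -- For large exponents the syzygy of `C` is projective and the sequence of syzygies splits.
  have hAB : (syzygyHom Λ)^[n] (K₀.mk A) = (syzygyHom Λ)^[n] (K₀.mk B) := by
    obtain ⟨K, f', g', hf', hfg', hg', hK⟩ := exists_shortExact_iterate_syzygy hf hfg hg n
    have hproj : Module.Projective Λ ↑(syzygy^[n] C) := by
      rw [IsProjective.iff_projective, projective_iff_hasProjectiveDimensionLT_one]
      exact (hasProjectiveDimensionLT_iterate_syzygy_iff C n 0).1 (by simpa using hCn)
    obtain ⟨s, hs⟩ := Module.projective_lifting_property g' LinearMap.id hg'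
    obtain ⟨e⟩ := nonempty_equiv_prod_of_leftInverse hs
    rw [← hK, iterate_syzygyHom_mk]
    have e' : ↑(syzygy^[n] A) ≃ₗ[Λ] LinearMap.ker g' :=
      LinearEquiv.ofInjective f' hf' ≪≫ₗ
        LinearEquiv.ofEq _ _ (LinearMap.exact_iff.1 hfg').symm
    rw [K₀.mk_eq_add (M' := syzygy^[n] C) (M'' := FGModuleCat.of Λ (LinearMap.ker g')) e,
      K₀.mk_eq_zero hproj, zero_add]
    exact K₀.mk_congr e'
  -- By the choice of `φ`, the two classes agree from the exponent `φ(W)` on.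
  have hφ := iterate_phi_eq_of_iterate_eq (mk_mem_addSpan A W hA) hB hAB
  obtain ⟨K, f', g', hf', hfg', hg', hK⟩ := exists_shortExact_iterate_syzygy hf hfg hg (phi W)
  rw [← hK, iterate_syzygyHom_mk] at hφ
  have hCφ := (hasProjectiveDimensionLT_iterate_syzygy_iff C (phi W) n).1
    (hasProjectiveDimensionLT_of_ge _ (n + 1) _ (by omega))
  obtain ⟨Y, hYA, hY, hYC⟩ := exists_isSummand_pd_le hf' hfg' hg' hφ hCφ
  obtain ⟨m, hm⟩ := ENat.ne_top_iff_exists.1 hY.ne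
  have h1 : pd C ≤ (m + 1 + phi W : ℕ) :=
    (pd_le_iff C _).2 ((hasProjectiveDimensionLT_iterate_syzygy_iff C (phi W) (m + 1)).2
      (hYC m hm.symm.le))
  have h2 : (m : ℕ∞) ≤ sSup {d : ℕ∞ | ∃ N N' : FGModuleCat.{u} Λ,
      Nonempty (syzygy^[phi W] W ≃ₗ[Λ] N × N') ∧ pd N < ⊤ ∧ d = pd N} := by
    obtain ⟨N', hN'⟩ := hYA.trans (hA.iterate_syzygy (phi W))
    exact le_sSup ⟨Y, N', hN', hY, hm⟩
  refine h1.trans ?_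
  rw [psi]
  push_cast
  calc (m : ℕ∞) + 1 + phi W = phi W + m + 1 := by ring
    _ ≤ _ := by gcongr

variable {M' M M'' : FGModuleCat.{u} Λ} {f : M' →ₗ[Λ] M} {g : M →ₗ[Λ] M''}

/-- The sequence `0 → Ω M'' → M' × P(M'') → M → 0` bounds the projective dimension of the middle
term of a short exact sequence. -/
theorem pd_middle_le_psi (hf : Function.Injective f) (hfg : Function.Exact f g)
    (hg : Function.Surjective g) (hM : pd M < ⊤) :
    pd M ≤ psi (FGModuleCat.of Λ (M' × syzygy M'')) + 1 := by
  have hπ := isProjectiveCover_projCoverMap M''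
  have := hπ.projective
  set π := projCoverMap M''
  obtain ⟨h, hh⟩ := Module.projective_lifting_property g π hg
  have hh' : ∀ x, g (h x) = π x := LinearMap.congr_fun hh
  let r : (FGModuleCat.of Λ (M' × projCover M'')) →ₗ[Λ] M := f.coprod h
  have hr' : ∀ x y, r (x, y) = f x + h y := fun x y => rfl
  have hgr : ∀ x y, g (r (x, y)) = π y := fun x y => by
    rw [hr', map_add, hfg.apply_apply_eq_zero, zero_add, hh']
  have hr : Function.Surjective r := by
    intro b
    obtain ⟨y, hy⟩ := hπ.surjective (g b)
    obtain ⟨a, ha⟩ := (hfg (b - h y)).1 (by rw [map_sub, hh', hy, sub_self])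
    exact ⟨(a, y), by rw [hr', ha]; abel⟩
  let t : LinearMap.ker r →ₗ[Λ] LinearMap.ker π :=
    (LinearMap.snd Λ M' (projCover M'')).restrict fun x hx => by
      have hx' : r (x.1, x.2) = 0 := hx
      change π x.2 = 0
      rw [← hgr x.1, hx', map_zero]
  have ht : Function.Bijective t := by
    constructor
    · rw [injective_iff_map_eq_zero]
      rintro ⟨⟨x, y⟩, hxy⟩ h0
      obtain rfl : y = 0 := congrArg Subtype.val h0
      have hxy' : f x + h 0 = 0 := hxy
      rw [map_zero, add_zero] at hxy'
      obtain rfl : x = 0 := hf (by rw [hxy', map_zero])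
      rfl
    · rintro ⟨y, hy⟩
      have hy' : π y = 0 := hy
      obtain ⟨a, ha⟩ := (hfg (h y)).1 (by rw [hh', hy'])
      refine ⟨⟨(-a, y), ?_⟩, rfl⟩
      change f (-a) + h y = 0
      rw [map_neg, ha, neg_add_cancel]
  have e : syzygy M'' ≃ₗ[Λ] LinearMap.ker r := (LinearEquiv.ofBijective t ht).symm
  refine pd_le_psi_add_one (A := FGModuleCat.of Λ (LinearMap.ker r))
    (B := FGModuleCat.of Λ (M' × projCover M'')) (f := (LinearMap.ker r).subtype) (g := r)
    (LinearMap.ker r).injective_subtype (LinearMap.exact_subtype_ker_map r) hr ?_ ?_ hM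
  · exact ⟨M', ⟨LinearEquiv.prodComm Λ M' (syzygy M'') ≪≫ₗ e.prodCongr (LinearEquiv.refl Λ M')⟩⟩
  · rw [K₀.mk_eq_add (M := FGModuleCat.of Λ (M' × projCover M'')) (LinearEquiv.refl Λ _),
      K₀.mk_eq_zero hπ.projective, add_zero]
    exact mk_mem_addSpan _ _ ⟨syzygy M'', ⟨LinearEquiv.refl Λ _⟩⟩

/-- The sequence `0 → Ω M → L → M' → 0`, where `L` is the kernel of `P(M) → M''`, bounds the
projective dimension of the first term of a short exact sequence. -/
theorem pd_left_le_psi (hf : Function.Injective f) (hfg : Function.Exact f g)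
    (hg : Function.Surjective g) (hM' : pd M' < ⊤) :
    pd M' ≤ psi (FGModuleCat.of Λ (syzygy M × syzygy M'')) + 1 := by
  have hπ := isProjectiveCover_projCoverMap M
  have := hπ.projective
  set π := projCoverMap M
  let q : projCover M →ₗ[Λ] M'' := g ∘ₗ π
  have hq : Function.Surjective q := hg.comp hπ.surjective
  let r : LinearMap.ker q →ₗ[Λ] M' := (LinearEquiv.ofInjective f hf).symm.toLinearMap ∘ₗ
    π.restrict (p := LinearMap.ker q) (q := LinearMap.range f) fun x hx => (hfg (π x)).1 hx
  have hr' : ∀ x, f (r x) = π x := fun x => by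
    have := LinearEquiv.apply_symm_apply (LinearEquiv.ofInjective f hf)
      (π.restrict (p := LinearMap.ker q) (q := LinearMap.range f) (fun x hx => (hfg (π x)).1 hx) x)
    exact congrArg Subtype.val this
  have hle : LinearMap.ker π ≤ LinearMap.ker q := LinearMap.ker_le_ker_comp π g
  refine pd_le_psi_add_one (A := syzygy M) (B := FGModuleCat.of Λ (LinearMap.ker q))
    (f := Submodule.inclusion hle) (g := r) (Submodule.inclusion_injective hle) ?_ ?_ ?_ ?_ hM'
  · intro x
    have : r x = 0 ↔ π x = 0 := by
      rw [← hr', map_eq_zero_iff f hf]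
    rw [this]
    constructor
    · exact fun hx => ⟨⟨x, hx⟩, rfl⟩
    · rintro ⟨y, rfl⟩
      exact y.2
  · intro y
    obtain ⟨x, hx⟩ := hπ.surjective (f y)
    refine ⟨⟨x, ?_⟩, hf ?_⟩
    · change g (π x) = 0
      rw [hx, hfg.apply_apply_eq_zero]
    · exact (hr' _).trans hx
  · exact ⟨syzygy M'', ⟨LinearEquiv.refl Λ _⟩⟩
  · rw [mk_ker_eq_mk_syzygy hq]
    exact mk_mem_addSpan _ _ ⟨syzygy M, ⟨LinearEquiv.prodComm Λ _ _⟩⟩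

end Syzygy

end IgusaTodorov

theorem mainTheorem11 {A : Type u} [Ring A] [IgusaTodorov.IsArtinAlgebra A]
    (M' M M'' : FGModuleCat.{u} Aᵐᵒᵖ) (f : M' →ₗ[Aᵐᵒᵖ] M) (g : M →ₗ[Aᵐᵒᵖ] M'')
    (hf : Function.Injective f) (hfg : Function.Exact f g) (hg : Function.Surjective g) :
    (IgusaTodorov.pd M < ⊤ →
      IgusaTodorov.pd M ≤
        IgusaTodorov.psi (FGModuleCat.of Aᵐᵒᵖ (M' × IgusaTodorov.syzygy M'')) + 1) ∧
    (IgusaTodorov.pd M' < ⊤ →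
      IgusaTodorov.pd M' ≤
        IgusaTodorov.psi
          (FGModuleCat.of Aᵐᵒᵖ (IgusaTodorov.syzygy M × IgusaTodorov.syzygy M'')) + 1) :=
  ⟨IgusaTodorov.pd_middle_le_psi hf hfg hg, IgusaTodorov.pd_left_le_psi hf hfg hg⟩
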